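/- Let $F$ be an infinite field of characteristic $2$ and let $T\subseteq F$ be a transcendence basis of $F$ over $\mathbf F_2$. Suppose that the multiplicative group $F^\times$ is indecomposable, i.e. not isomorphic to a direct sum of two nontrivial groups. Then $T$ is nonempty and the following hold. 1. $F^\times$ is a torsion-free abelian group of infinite rank, where the rank is the cardinality of a maximal $\mathbf Z$-linearly independent subset. 2. $F$ is an algebraic extension of $\mathbf F_2(T)$ of infinite degree. Moreover, $F$ is not a finite extension of any rational function field $k(S)$, where $k$ is a field and $S$ is a nonempty set of variables. In particular, $F$ is not an algebraic function field of $n\ge 1$ variables over a field $k$ (a finite extension of $k(x_1,\dots,x_n)$), not a global field (a number field, or a finite extension of $\mathbf F_p(t)$ for a prime $p$), and not a finitely generated field (a field generated over its prime field by finitely many elements). 3. If $T$ is finite, then $F$ cannot be generated over $\mathbf F_2(T)$ by algebraic elements of bounded degree; that is, there are no set $S\subseteq F$ of elements algebraic over $\mathbf F_2(T)$ and integer $d$ such that every element of $S$ has degree at most $d$ over $\mathbf F_2(T)$ and $F=\mathbf F_2(T)(S)$. -/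

import Mathlib

open Cardinal

universe u v w

/-- An abelian group is indecomposable if it is not isomorphic to a direct sum (here a product of two
groups) of two nontrivial groups. Restricting the two factors to the universe of `G` loses nothing,
since each factor embeds into `G`. -/
def IsIndecomposableGroup (G : Type u) [CommGroup G] : Prop :=
  ∀ (A B : Type u) [CommGroup A] [CommGroup B], Nontrivial A → Nontrivial B → IsEmpty (G ≃* A × B)

/-- `K` is (via some embedding) a finite extension of the field `k(S)` of rational functions over `k`
in the variables `S`. -/
def IsFiniteExtensionOfRationalFunctions (k : Type v) [Field k] (S : Type w) (K : Type u) [Field K] :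
    Prop :=
  ∃ φ : FractionRing (MvPolynomial S k) →+* K, φ.Finite

/-- `K` is an algebraic function field of `n` variables over `k`. -/
def IsAlgebraicFunctionField (k : Type v) [Field k] (n : ℕ) (K : Type u) [Field K] : Prop :=
  IsFiniteExtensionOfRationalFunctions k (Fin n) K

/-- `K` is a global field: a number field, or a finite extension of `𝔽_p(t)` for a prime `p`. -/
def IsGlobalField (K : Type u) [Field K] : Prop :=
  NumberField K ∨ ∃ (p : ℕ) (_ : Fact p.Prime) (φ : RatFunc (ZMod p) →+* K), φ.Finite

/-- `K` is a finitely generated field: it is generated, as a field, by finitely many elements. -/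
def IsFinitelyGeneratedField (K : Type u) [Field K] : Prop :=
  ∃ s : Set K, s.Finite ∧ Subfield.closure s = ⊤

/-- The field extension `K / k` is generated by algebraic elements whose degrees over `k` are
bounded. -/
def IsGeneratedByAlgebraicElementsOfBoundedDegree (k : Type v) [Field k] (K : Type u) [Field K]
    [Algebra k K] : Prop :=
  ∃ (S : Set K) (d : ℕ), (∀ x ∈ S, IsAlgebraic k x ∧ (minpoly k x).natDegree ≤ d) ∧
    IntermediateField.adjoin k S = ⊤

/-!
An idempotent endomorphism of an indecomposable abelian group is trivial or the identity. This is used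
in two ways.

*Torsion.* The `p`-primary torsion of the multiplicative group of a field consists of roots of unity, so
it is either divisible or cyclic and pure; in both cases it is a direct summand
(`Units.exists_retraction_primary`). If it is nontrivial it is thus all of `Fˣ`. Every finite subfield
then has `2 ^ m = p ^ a + 1` elements, which forces `a ≤ 1`, and `F` would be finite. Hence `Fˣ` is
torsion-free and only `0` and `1` are algebraic over `𝔽₂`. So `F` contains a transcendental `t`, and the
irreducible polynomials in `t` show that the rank is infinite.

*Homomorphisms to `ℤ`.* The image of a nontrivial homomorphism `Fˣ → ℤ` is infinite cyclic and splits
off, so `Fˣ` would be cyclic, contradicting the infinite rank. Thus every homomorphism `Fˣ → ℤ` is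
trivial (`IsIndecomposableGroup.hom_int_eq_one`), and the negative assertions follow by constructing a
nontrivial one. If `F` is finite over `k(S)`, one takes the total degree of the norm.

If `F` is generated in bounded degree over `K = 𝔽₂(T)` with `T` finite, there need not be a discrete
valuation on `F`. However, `Fˣ` is a countable torsion-free group, and in such a group a homomorphism to
`ℤ` extends step by step along a chain of finitely generated pure subgroups
(`Module.exists_linearForm_ne_zero_of_countable`). What has to be seen is that the pure closure of a
finitely generated subgroup `H` is again finitely generated. It is generated by `H` and the elements `a`
such that `a ^ n` is a product of the generators of `H` with exponents at most `n`. Up to a fixed power of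
two, which makes them separable, these have bounded degree over `K`
(`natDegree_minpoly_le_of_pow_mem`), and their minimal polynomials have coefficients in a finite set
(`finite_setOf_pow_eq_prod_of_natDegree_le`).
-/

/-! ### Indecomposable groups -/

/-- An idempotent endomorphism splits an abelian group as the product of its range and kernel, so that
of an indecomposable group is trivial or the identity. -/
theorem IsIndecomposableGroup.eq_one_or_eq_id {G : Type u} [CommGroup G]
    (hG : IsIndecomposableGroup G) (r : G →* G) (hr : ∀ g, r (r g) = r g) :
    (∀ g, r g = 1) ∨ ∀ g, r g = g := by
  by_contra! h
  obtain ⟨⟨x, hx⟩, y, hy⟩ := h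
  have e : G ≃* r.range × r.ker :=
    { toFun g := (⟨r g, g, rfl⟩, ⟨g * (r g)⁻¹, by simp [MonoidHom.mem_ker, hr]⟩)
      invFun p := p.1 * p.2
      left_inv g := by simp
      right_inv := by
        rintro ⟨⟨_, a, rfl⟩, ⟨b, hb⟩⟩
        have hb : r b = 1 := hb
        simp [hr, hb]
      map_mul' a b := by
        ext
        · simp
        · change a * b * (r (a * b))⁻¹ = a * (r a)⁻¹ * (b * (r b)⁻¹)
          rw [map_mul, mul_inv, mul_mul_mul_comm] }
  refine (hG r.range r.ker ⟨⟨r x, x, rfl⟩, 1, fun h => hx (congrArg Subtype.val h)⟩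
    ⟨⟨y * (r y)⁻¹, by simp [MonoidHom.mem_ker, hr]⟩, 1, fun h => hy ?_⟩).elim e
  exact (mul_inv_eq_one.1 (congrArg Subtype.val h)).symm

/-- A nontrivial homomorphism to `ℤ` has a cyclic image, which is free and so splits off; the
indecomposable group is then this cyclic group. -/
theorem IsIndecomposableGroup.isCyclic_of_hom {G : Type u} [CommGroup G]
    (hG : IsIndecomposableGroup G) (f : G →* Multiplicative ℤ) {x : G} (hx : f x ≠ 1) :
    IsCyclic G := by
  obtain ⟨⟨_, s, rfl⟩, hs⟩ := IsCyclic.exists_generator (α := f.range)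
  have key : ∀ g, ∃ n : ℤ, f s ^ n = f g := fun g => by
    obtain ⟨n, hn⟩ := hs ⟨f g, g, rfl⟩
    exact ⟨n, congrArg Subtype.val hn⟩
  have hs1 : f s ≠ 1 := fun h => by
    obtain ⟨n, hn⟩ := key x
    rw [h, one_zpow] at hn
    exact hx hn.symm
  choose n hn using key
  have inj : ∀ a b : ℤ, f s ^ a = f s ^ b → a = b := fun a b h => by
    have h' : a * (f s).toAdd = b * (f s).toAdd := by simpa using congrArg Multiplicative.toAdd h
    exact mul_right_cancel₀ (fun h0 => hs1 (Multiplicative.toAdd.injective h0)) h'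
  let r : G →* G := MonoidHom.mk' (fun g => s ^ n g) fun a b => by
    rw [← zpow_add]
    congr 1
    apply inj
    rw [hn, map_mul, zpow_add, hn, hn]
  have hr : ∀ g, f (r g) = f g := fun g => by simp [r, MonoidHom.mk', hn]
  obtain h | h := hG.eq_one_or_eq_id r fun g => by
    change s ^ n (r g) = s ^ n g
    congr 1
    apply inj
    rw [hn, hn, hr]
  · exact absurd (by rw [← hr, h, map_one]) hx
  · exact ⟨s, fun g => ⟨n g, h g⟩⟩

/-- Divisible abelian groups are injective: homomorphisms to them extend along injective ones. -/
theorem MonoidHom.exists_extension_of_divisible {H Q D : Type*} [CommGroup H] [CommGroup Q] [CommGroup D]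
    (hD : ∀ n : ℕ, n ≠ 0 → ∀ x : D, ∃ y : D, y ^ n = x) (i : H →* Q) (hi : Function.Injective i)
    (f : H →* D) : ∃ g : Q →* D, ∀ x, g (i x) = f x := by
  let : DivisibleBy (Additive D) ℕ := divisibleByOfSMulRightSurj _ _ fun {n} hn x => by
    obtain ⟨y, hy⟩ := hD n hn x.toMul
    exact ⟨Additive.ofMul y, congrArg Additive.ofMul hy⟩
  let : DivisibleBy (Additive D) ℤ := AddGroup.divisibleByIntOfDivisibleByNat _
  obtain ⟨g, hg⟩ := (Module.Baer.of_divisible (Additive D)).extension_property_addMonoidHom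
    (MonoidHom.toAdditive i) hi (MonoidHom.toAdditive f)
  exact ⟨MonoidHom.toAdditive.symm g, fun x => DFunLike.congr_fun hg (Additive.ofMul x)⟩

/-! ### Homomorphisms to the integers -/

/-- A linear form on a pure submodule `P` extends to a finitely generated `Q ≥ P`: the quotient is
finitely generated and torsion-free, hence free, and splits off. -/
theorem Submodule.exists_linearForm_extension_of_pure {M : Type*} [AddCommGroup M]
    (P Q : Submodule ℤ M) (hPQ : P ≤ Q) (hQ : Q.FG) (hP : ∀ n : ℤ, n ≠ 0 → ∀ x, n • x ∈ P → x ∈ P)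
    (f : P →ₗ[ℤ] ℤ) : ∃ g : Q →ₗ[ℤ] ℤ, ∀ x : P, g ⟨x, hPQ x.2⟩ = f x := by
  let P' : Submodule ℤ Q := P.submoduleOf Q
  have : Module.Finite ℤ Q := Module.Finite.iff_fg.2 hQ
  have : Module.IsTorsionFree ℤ (Q ⧸ P') := by
    rw [Module.isTorsionFree_iff_smul_eq_zero]
    intro n x h
    induction x using Submodule.Quotient.induction_on with
    | H x =>
      rw [← Submodule.Quotient.mk_smul, Submodule.Quotient.mk_eq_zero] at h
      rw [Submodule.Quotient.mk_eq_zero]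
      exact or_iff_not_imp_left.2 fun hn => hP n hn _ h
  obtain ⟨s, hs⟩ := Module.projective_lifting_property P'.mkQ LinearMap.id P'.mkQ_surjective
  let t : Q →ₗ[ℤ] Q := LinearMap.id - s ∘ₗ P'.mkQ
  have ht : ∀ x, t x ∈ P' := fun x => by
    rw [← Submodule.Quotient.mk_eq_zero, ← Submodule.mkQ_apply]
    have := LinearMap.congr_fun hs (P'.mkQ x)
    simp only [LinearMap.comp_apply, LinearMap.id_apply] at this
    simp [t, -Submodule.mkQ_apply, this]
  let e : P' →ₗ[ℤ] P := LinearMap.codRestrict P (Q.subtype ∘ₗ P'.subtype) fun x => x.2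
  refine ⟨f ∘ₗ e ∘ₗ t.codRestrict P' ht, fun x => ?_⟩
  have : P'.mkQ ⟨x, hPQ x.2⟩ = 0 := (Submodule.Quotient.mk_eq_zero _).2 x.2
  have hx : t ⟨x, hPQ x.2⟩ = ⟨x, hPQ x.2⟩ := by
    simp only [t, LinearMap.sub_apply, LinearMap.comp_apply, this, map_zero, sub_zero,
      LinearMap.id_apply]
  exact congrArg f (Subtype.ext (show ((t ⟨x, hPQ x.2⟩ : Q) : M) = x from
    congrArg Subtype.val hx))

/-- In a countable torsion-free abelian group all of whose finitely generated subgroups have a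
finitely generated pure closure, every nonzero element is detected by a homomorphism to `ℤ`. -/
theorem Module.exists_linearForm_ne_zero_of_countable {M : Type*} [AddCommGroup M]
    [Module.IsTorsionFree ℤ M] [Countable M]
    (hM : ∀ s : Finset M, ∃ Q : Submodule ℤ M, Q.FG ∧
      ∀ x, x ∈ Q ↔ ∃ n : ℤ, n ≠ 0 ∧ n • x ∈ Submodule.span ℤ (s : Set M))
    {x : M} (hx : x ≠ 0) : ∃ f : M →ₗ[ℤ] ℤ, f x ≠ 0 := by
  classical
  obtain ⟨e, he⟩ := exists_surjective_nat M
  let s : ℕ → Finset M := fun n => insert x ((Finset.range n).image e)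
  have hs : Monotone s := fun a b h =>
    Finset.insert_subset_insert _ (Finset.image_subset_image (by simpa using h))
  choose Q hQ hmem using hM
  let P : ℕ → Submodule ℤ M := fun n => Q (s n)
  have hP : Monotone P := fun a b h y hy => by
    obtain ⟨n, hn, h'⟩ := (hmem _ _).1 hy
    exact (hmem _ _).2 ⟨n, hn, Submodule.span_mono (Finset.coe_subset.2 (hs h)) h'⟩
  have hsP : ∀ n, ∀ y ∈ s n, y ∈ P n := fun n y hy =>
    (hmem _ _).2 ⟨1, one_ne_zero, by simpa using Submodule.subset_span (by exact_mod_cast hy)⟩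
  have hpure : ∀ n, ∀ a : ℤ, a ≠ 0 → ∀ y, a • y ∈ P n → y ∈ P n := fun n a ha y hy => by
    obtain ⟨b, hb, h⟩ := (hmem _ _).1 hy
    exact (hmem _ _).2 ⟨b * a, mul_ne_zero hb ha, by rwa [mul_smul]⟩
  have hfin : ∀ n, Module.Finite ℤ (P n) := fun n => Module.Finite.iff_fg.2 (hQ _)
  have hx0 : x ∈ P 0 := hsP 0 x (Finset.mem_insert_self _ _)
  obtain ⟨f₀, hf₀⟩ : ∃ f : P 0 →ₗ[ℤ] ℤ, f ⟨x, hx0⟩ ≠ 0 := by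
    by_contra! h
    have := (Module.forall_dual_apply_eq_zero_iff ℤ (⟨x, hx0⟩ : P 0)).1 h
    exact hx (congrArg Subtype.val this)
  choose ext hext using fun n (f : P n →ₗ[ℤ] ℤ) =>
    Submodule.exists_linearForm_extension_of_pure (P n) (P (n + 1)) (hP n.le_succ) (hQ _)
      (hpure n) f
  let f : ∀ n, P n →ₗ[ℤ] ℤ := fun n => Nat.rec f₀ ext n
  let F : ℕ → M →ₗ.[ℤ] ℤ := fun n => ⟨P n, f n⟩
  have hF : Monotone F := monotone_nat_of_le_succ fun n => by
    refine ⟨hP n.le_succ, ?_⟩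
    rintro ⟨y, hy⟩ ⟨z, hz⟩ (rfl : y = z)
    exact (hext n (f n) ⟨y, hy⟩).symm
  have hdir : DirectedOn (· ≤ ·) (Set.range F) := (hF.directed_le).directedOn_range
  let g := LinearPMap.sSup (Set.range F) hdir
  have hg : g.domain = ⊤ := by
    rw [eq_top_iff]
    rintro y -
    obtain ⟨n, rfl⟩ := he y
    refine (LinearPMap.mem_domain_sSup_iff (Set.range_nonempty F) hdir).2
      ⟨F (n + 1), ⟨_, rfl⟩, hsP (n + 1) _ ?_⟩
    exact Finset.mem_insert_of_mem (Finset.mem_image_of_mem _ (by simp))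
  refine ⟨g.toFun ∘ₗ LinearMap.codRestrict g.domain LinearMap.id fun y => hg ▸ trivial, ?_⟩
  have := LinearPMap.sSup_apply hdir ⟨0, rfl⟩ (⟨x, hx0⟩ : (F 0).domain)
  exact fun h => hf₀ (this.symm.trans h)

/-! ### Torsion in indecomposable multiplicative groups -/

theorem infinite_units (F : Type*) [Field F] [Infinite F] : Infinite Fˣ := by
  by_contra h
  rw [not_infinite_iff_finite] at h
  exact (Set.infinite_univ (α := F)) (((Set.finite_range ((↑) : Fˣ → F)).insert 0).subset
    fun x _ => or_iff_not_imp_left.2 fun h => ⟨Units.mk0 x h, rfl⟩)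

/-- If the unit group of a field contains elements of every order `p ^ k`, its `p`-primary torsion
is divisible. -/
theorem Units.exists_pow_eq_of_pow_prime_pow_eq_one {F : Type*} [Field F] {p : ℕ} (hp : p.Prime)
    (h : ∀ k, ∃ y : Fˣ, orderOf y = p ^ k) {n : ℕ} (hn : n ≠ 0) {x : Fˣ} {j : ℕ}
    (hx : x ^ p ^ j = 1) : ∃ y : Fˣ, (∃ k, y ^ p ^ k = 1) ∧ y ^ n = x := by
  obtain ⟨a, m, hm, rfl⟩ := Nat.exists_eq_pow_mul_and_not_dvd hn p hp.ne_one
  obtain ⟨y, hy⟩ := h (a + j)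
  have hprim : IsPrimitiveRoot (y ^ p ^ a) (p ^ j) :=
    (IsPrimitiveRoot.iff_orderOf.2 hy).pow (pow_pos hp.pos _) (pow_add _ _ _)
  have : NeZero (p ^ j) := ⟨(pow_pos hp.pos _).ne'⟩
  obtain ⟨i, -, hi⟩ := (IsPrimitiveRoot.coe_units_iff.2 hprim).eq_pow_of_pow_eq_one
    (ξ := (x : F)) (by rw [← Units.val_pow_eq_pow_val, hx, Units.val_one])
  have hi : (y ^ p ^ a) ^ i = x := by exact_mod_cast hi
  have hu : (y ^ i) ^ p ^ (a + j) = 1 := by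
    rw [pow_right_comm, ← hy, pow_orderOf_eq_one, one_pow]
  have hcop : m.Coprime (orderOf (y ^ i)) :=
    Nat.Coprime.coprime_dvd_right (orderOf_dvd_of_pow_eq_one hu)
      (Nat.Coprime.pow_right _ ((Nat.Prime.coprime_iff_not_dvd hp).2 hm).symm)
  obtain ⟨l, hl⟩ := exists_pow_eq_self_of_coprime hcop
  refine ⟨(y ^ i) ^ l, ⟨a + j, by rw [pow_right_comm, hu, one_pow]⟩, ?_⟩
  calc ((y ^ i) ^ l) ^ (p ^ a * m) = (((y ^ i) ^ m) ^ l) ^ p ^ a := by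
        simp only [← pow_mul]; congr 1; ring
    _ = x := by rw [hl, pow_right_comm, hi]

/-- The `p`-primary torsion of the unit group of a field is a direct summand: it is either divisible
or cyclic of order `p ^ n`, and in the second case pure. -/
theorem Units.exists_retraction_primary {F : Type*} [Field F] {p : ℕ} (hp : p.Prime) :
    ∃ r : Fˣ →* Fˣ, (∀ x, ∃ k, r x ^ p ^ k = 1) ∧ ∀ x k, x ^ p ^ k = 1 → r x = x := by
  let T : Subgroup Fˣ :=
    { carrier := {x | ∃ k, x ^ p ^ k = 1}
      one_mem' := ⟨0, one_pow _⟩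
      mul_mem' := by
        rintro a b ⟨k, hk⟩ ⟨l, hl⟩
        exact ⟨k + l, by
          rw [mul_pow, pow_add, pow_mul, hk, one_pow, one_mul, mul_comm, pow_mul, hl, one_pow]⟩
      inv_mem' := by
        rintro a ⟨k, hk⟩
        exact ⟨k, by rw [inv_pow, hk, inv_one]⟩ }
  by_cases h : ∀ k, ∃ y : Fˣ, orderOf y = p ^ k
  · obtain ⟨r, hr⟩ := MonoidHom.exists_extension_of_divisible (D := T) (fun n hn x => by
      obtain ⟨j, hj⟩ := x.2
      obtain ⟨y, hy, hyx⟩ := Units.exists_pow_eq_of_pow_prime_pow_eq_one hp h hn hj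
      exact ⟨⟨y, hy⟩, Subtype.ext hyx⟩) T.subtype T.subtype_injective (MonoidHom.id T)
    exact ⟨T.subtype.comp r, fun x => (r x).2,
      fun x k hx => congrArg Subtype.val (hr ⟨x, k, hx⟩)⟩
  · obtain ⟨n, ⟨y, hy⟩, hn⟩ : ∃ n, (∃ y : Fˣ, orderOf y = p ^ n) ∧
        ∀ x : Fˣ, orderOf x ≠ p ^ (n + 1) := by
      by_contra! h'
      refine h fun k => ?_
      induction k with
      | zero => exact ⟨1, by simp⟩
      | succ k ih => exact h' k ih
    have hT : ∀ x : Fˣ, ∀ k, x ^ p ^ k = 1 → x ^ p ^ n = 1 := fun x k hx => by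
      obtain ⟨j, -, hj⟩ := (Nat.dvd_prime_pow hp).1 (orderOf_dvd_of_pow_eq_one hx)
      obtain hjn | hjn := le_or_gt j n
      · exact orderOf_dvd_iff_pow_eq_one.1 (hj ▸ pow_dvd_pow p hjn)
      · refine absurd ?_ (hn (x ^ p ^ (j - (n + 1))))
        have hjn' : j = j - (n + 1) + (n + 1) := by omega
        refine ((IsPrimitiveRoot.iff_orderOf.2 hj).pow (pow_pos hp.pos _) ?_).eq_orderOf.symm
        rw [← pow_add, ← hjn']
    let L := AlgebraicClosure F
    let i : Fˣ →* Lˣ := Units.map (algebraMap F L)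
    have hi : Function.Injective i := Units.map_injective (algebraMap F L).injective
    let N : Subgroup Fˣ := (powMonoidHom (p ^ n)).range
    obtain ⟨χ, hχ⟩ := MonoidHom.exists_extension_of_divisible (Q := Fˣ ⧸ N) (D := Lˣ) (fun m hm x => by
      obtain ⟨z, hz⟩ := IsAlgClosed.exists_pow_nat_eq (x : L) (Nat.pos_of_ne_zero hm)
      exact ⟨Units.mk0 z (by rintro rfl; simp [hm] at hz; exact x.ne_zero hz.symm),
        Units.ext hz⟩) ((QuotientGroup.mk' N).comp T.subtype)
      ((injective_iff_map_eq_one _).2 fun x hx => by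
        obtain ⟨z, hz⟩ := (QuotientGroup.eq_one_iff (x : Fˣ)).1 hx
        obtain ⟨k, hk⟩ := x.2
        have hz : z ^ p ^ n = x := hz
        refine Subtype.ext (hz.symm.trans (hT z (n + k) ?_))
        rw [pow_add, pow_mul, hz, hk]) (i.comp T.subtype)
    have key : ∀ g : Fˣ, ∃ t : Fˣ, t ^ p ^ n = 1 ∧ i t = χ (QuotientGroup.mk' N g) := fun g => by
      have h1 : χ (QuotientGroup.mk' N g) ^ p ^ n = 1 := by
        have hg : QuotientGroup.mk' N (g ^ p ^ n) = 1 :=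
          (QuotientGroup.eq_one_iff (g ^ p ^ n)).2 ⟨g, rfl⟩
        rw [← map_pow, ← map_pow, hg, map_one]
      have : NeZero (p ^ n) := ⟨(pow_pos hp.pos _).ne'⟩
      obtain ⟨j, -, hj⟩ := (IsPrimitiveRoot.coe_units_iff.2
        ((IsPrimitiveRoot.iff_orderOf.2 hy).map_of_injective hi)).eq_pow_of_pow_eq_one
        (ξ := (χ (QuotientGroup.mk' N g) : L))
        (by rw [← Units.val_pow_eq_pow_val, h1, Units.val_one])
      refine ⟨y ^ j, by rw [pow_right_comm, ← hy, pow_orderOf_eq_one, one_pow], ?_⟩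
      rw [map_pow]
      exact_mod_cast hj
    choose r hr hir using key
    refine ⟨MonoidHom.mk' r fun a b => hi ?_, fun x => ⟨n, hr x⟩, fun x k hx => hi ?_⟩
    · rw [map_mul, hir, hir, hir, map_mul, map_mul]
    · exact (hir x).trans (hχ ⟨x, k, hx⟩)

/-- A power of two exceeds a power of an odd number `p > 1` by one only for exponents of `p` at most
one. -/
theorem Nat.le_one_of_two_pow_eq_odd_pow_add_one {p m a : ℕ} (hp : Odd p) (h1 : 1 < p)
    (h : 2 ^ m = p ^ a + 1) : a ≤ 1 := by
  obtain ha | ha := Nat.even_or_odd a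
  · obtain ⟨b, rfl⟩ := ha
    -- an odd square is `1` modulo `4`
    obtain ⟨c, hc⟩ := hp.pow (n := b)
    rw [← two_mul, mul_comm, pow_mul, hc] at h
    match m with
    | 0 => simp at h
    | 1 =>
      have : c = 0 := by nlinarith
      subst this
      have hb : b = 0 := by
        by_contra hb
        exact (Nat.one_lt_pow hb h1).ne' (by simpa using hc)
      omega
    | m + 2 =>
      exfalso
      have : 4 * 2 ^ m = 4 * (c * c + c) + 2 := by rw [pow_add] at h; linarith
      omega
  · -- `p + 1` is a power of two, and the exact power of two dividing `p ^ a + 1`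
    obtain ⟨j, -, hj⟩ := (Nat.dvd_prime_pow Nat.prime_two).1
      (show p + 1 ∣ 2 ^ m by simpa [h] using ha.nat_add_dvd_pow_add_pow p 1)
    have h2 : emultiplicity (2 : ℤ) ((p : ℤ) ^ a - (-1) ^ a) = emultiplicity (2 : ℤ) (p - -1) :=
      emultiplicity_pow_sub_pow_of_prime Int.prime_two
        (by obtain ⟨c, rfl⟩ := hp; exact ⟨c + 1, by push_cast; ring⟩)
        (by obtain ⟨c, rfl⟩ := hp; push_cast; omega) (by obtain ⟨c, rfl⟩ := ha; push_cast; omega)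
    have h3 : (p : ℤ) ^ a - (-1) ^ a = 2 ^ m := by
      rw [ha.neg_one_pow]
      push_cast [← @Nat.cast_inj ℤ] at h
      linarith
    have h4 : (p : ℤ) - -1 = 2 ^ j := by push_cast [← @Nat.cast_inj ℤ] at hj; linarith
    rw [h3, h4, emultiplicity_pow_self_of_prime Int.prime_two,
      emultiplicity_pow_self_of_prime Int.prime_two] at h2
    have h2 : m = j := by exact_mod_cast h2
    rw [h2, ← hj] at h
    by_contra! h5
    have := Nat.pow_lt_pow_right h1 h5
    rw [pow_one] at this
    omega

section CharTwo

variable {F : Type u} [Field F] [Algebra (ZMod 2) F]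

/-- An infinite field of characteristic two with indecomposable unit group has no nontrivial
roots of unity. -/
theorem IsIndecomposableGroup.isMulTorsionFree_units [Infinite F]
    (hF : IsIndecomposableGroup Fˣ) : IsMulTorsionFree Fˣ := by
  have : CharP F 2 := charP_of_injective_algebraMap (algebraMap (ZMod 2) F).injective 2
  by_contra h
  rw [not_isMulTorsionFree_iff_isOfFinOrder] at h
  obtain ⟨x, hx1, hx⟩ := h
  obtain ⟨p, hp, hpx⟩ := Nat.exists_prime_and_dvd (mt orderOf_eq_one_iff.1 hx1)
  have := Fact.mk hp
  obtain ⟨y, hy⟩ : ∃ y : Fˣ, orderOf y = p :=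
    ⟨_, orderOf_pow_orderOf_div hx.orderOf_pos.ne' hpx⟩
  have hp2 : Odd p := hp.odd_of_ne_two fun hp2 => by
    have h1 : (y : F) ^ 2 = 1 := by
      rw [← Units.val_pow_eq_pow_val, ← hp2, ← hy, pow_orderOf_eq_one, Units.val_one]
    have h2 : ((y : F) - 1) ^ 2 = 0 := by rw [sub_pow_char, h1, one_pow, sub_self]
    have h3 : y = 1 := Units.ext (sub_eq_zero.1 (pow_eq_zero_iff two_ne_zero |>.1 h2))
    rw [h3, orderOf_one] at hy
    exact hp.one_lt.ne hy
  obtain ⟨r, hr, hr'⟩ := Units.exists_retraction_primary (F := F) hp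
  have hprim : ∀ z : Fˣ, ∃ k, z ^ p ^ k = 1 := by
    obtain h | h := hF.eq_one_or_eq_id r fun g => by
      obtain ⟨k, hk⟩ := hr g
      exact hr' _ k hk
    · have := (hr' y 1 (by rw [pow_one, ← hy, pow_orderOf_eq_one])).symm.trans (h y)
      rw [this, orderOf_one] at hy
      exact absurd hy hp.one_lt.ne
    · exact fun z => h z ▸ hr z
  -- every unit generates a finite field with `2 ^ m = p ^ a + 1` elements, so has order at most `p`
  have hpow : ∀ z : Fˣ, z ^ p = 1 := fun z => by
    obtain ⟨k, hk⟩ := hprim z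
    have hint : IsIntegral (ZMod 2) (z : F) := by
      refine IsIntegral.of_pow (pow_pos hp.pos k) ?_
      rw [← Units.val_pow_eq_pow_val, hk, Units.val_one]
      exact isIntegral_one
    let E := IntermediateField.adjoin (ZMod 2) {(z : F)}
    have : FiniteDimensional (ZMod 2) E := IntermediateField.adjoin.finiteDimensional hint
    have : Finite E := Module.finite_of_finite (ZMod 2)
    have hE : IsPGroup p Eˣ := fun w => by
      obtain ⟨k, hk⟩ := hprim (Units.map (algebraMap E F) w)
      exact ⟨k, Units.map_injective (algebraMap E F).injective (by
        rw [map_pow, map_one]; exact hk)⟩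
    obtain ⟨a, ha⟩ := IsPGroup.iff_card.1 hE
    have hcard : Nat.card E = 2 ^ Module.finrank (ZMod 2) E := by
      rw [Module.natCard_eq_pow_finrank (K := ZMod 2), Nat.card_zmod]
    rw [Nat.card_units, hcard] at ha
    have h1 : 2 ^ Module.finrank (ZMod 2) E = p ^ a + 1 := by
      have := Nat.one_le_two_pow (n := Module.finrank (ZMod 2) E)
      omega
    have ha1 := Nat.le_one_of_two_pow_eq_odd_pow_add_one hp2 hp.one_lt h1
    let w : Eˣ := Units.mk0 ⟨z, IntermediateField.mem_adjoin_simple_self _ _⟩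
      fun h => z.ne_zero (congrArg Subtype.val h)
    have hw : w ^ p = 1 := by
      refine orderOf_dvd_iff_pow_eq_one.1 ((orderOf_dvd_natCard w).trans ?_)
      rw [Nat.card_units, hcard, ha]
      simpa using pow_dvd_pow p ha1
    exact Units.ext (congrArg (fun u : Eˣ => ((u : E) : F)) hw)
  have : Finite Fˣ := by
    have : NeZero p := ⟨hp.ne_zero⟩
    have h : (⊤ : Subgroup Fˣ) = rootsOfUnity p F := by
      ext z
      simp [mem_rootsOfUnity, hpow z]
    have h1 : Finite (⊤ : Subgroup Fˣ) := by rw [h]; infer_instance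
    exact (Set.finite_univ_iff).1 h1
  exact (infinite_units F).not_finite this

theorem eq_zero_or_one_of_isAlgebraic_of_isMulTorsionFree_units [IsMulTorsionFree Fˣ] {x : F}
    (hx : IsAlgebraic (ZMod 2) x) : x = 0 ∨ x = 1 := by
  refine or_iff_not_imp_left.2 fun h0 => ?_
  let E := IntermediateField.adjoin (ZMod 2) {x}
  have : FiniteDimensional (ZMod 2) E := IntermediateField.adjoin.finiteDimensional hx.isIntegral
  have : Finite E := Module.finite_of_finite (ZMod 2)
  let w : Eˣ := Units.mk0 ⟨x, IntermediateField.mem_adjoin_simple_self _ _⟩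
    fun h => h0 (congrArg Subtype.val h)
  have h1 : Units.map (algebraMap E F : E →* F) w ^ Nat.card Eˣ = 1 := by
    rw [← map_pow, pow_card_eq_one', map_one]
  exact congrArg Units.val ((pow_eq_one_iff_left Nat.card_pos.ne').1 h1)

end CharTwo

/-! ### Discrete valuations and norms -/

/-- A degree function on a domain, additive on nonzero products, extends to a homomorphism from the
units of the fraction field to `ℤ`. -/
theorem IsFractionRing.exists_hom_int_of_degree {R K : Type*} [CommRing R] [IsDomain R] [Field K]
    [Algebra R K] [IsFractionRing R K] (d : R → ℕ)
    (hd : ∀ a b, a ≠ 0 → b ≠ 0 → d (a * b) = d a + d b) :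
    ∃ f : Kˣ →* Multiplicative ℤ, ∀ (a : R) (x : Kˣ), (x : K) = algebraMap R K a →
      f x = Multiplicative.ofAdd (d a : ℤ) := by
  have hd1 : d 1 = 0 := by simpa using hd 1 1 one_ne_zero one_ne_zero
  choose n m hm hnm using IsFractionRing.div_surjective R (K := K)
  have hm0 : ∀ x, m x ≠ 0 := fun x => nonZeroDivisors.ne_zero (hm x)
  have hmK : ∀ x, algebraMap R K (m x) ≠ 0 := fun x => by simpa using hm0 x
  have hn0 : ∀ x : Kˣ, n x ≠ 0 := fun x h => x.ne_zero (by rw [← hnm x, h]; simp)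
  -- the value does not depend on the representation as a fraction
  have key : ∀ (x : Kˣ) (a b : R), b ≠ 0 → (x : K) = algebraMap R K a / algebraMap R K b →
      (d (n x) : ℤ) - d (m x) = d a - d b := fun x a b hb hx => by
    have hbK : algebraMap R K b ≠ 0 := by simpa using hb
    have ha : a ≠ 0 := by
      rintro rfl
      exact x.ne_zero (by simp [hx])
    rw [← hnm x, div_eq_div_iff (hmK _) hbK, ← map_mul, ← map_mul] at hx
    have := congrArg d (IsFractionRing.injective R K hx)
    rw [hd _ _ (hn0 x) hb, hd _ _ ha (hm0 x)] at this
    omega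
  refine ⟨MonoidHom.mk' (fun x => Multiplicative.ofAdd ((d (n x) : ℤ) - d (m x))) fun x y => ?_,
    fun a x hx => ?_⟩
  · rw [← ofAdd_add, key (x * y) (n x * n y) (m x * m y) (mul_ne_zero (hm0 _) (hm0 _)),
      hd _ _ (hn0 x) (hn0 y), hd _ _ (hm0 x) (hm0 y)]
    · push_cast
      congr 1
      ring
    · rw [Units.val_mul, map_mul, map_mul, ← div_mul_div_comm, hnm, hnm]
  · change Multiplicative.ofAdd ((d (n x) : ℤ) - d (m x)) = _
    rw [key x a 1 one_ne_zero (by simpa using hx), hd1, Nat.cast_zero, sub_zero]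

/-- Composing with the norm carries a nontrivial homomorphism to `ℤ` to a finite extension. -/
theorem RingHom.Finite.exists_hom_int {K F : Type*} [Field K] [Field F] {φ : K →+* F}
    (hφ : φ.Finite) (v : Kˣ →* Multiplicative ℤ) {t : Kˣ} (ht : v t ≠ 1) :
    ∃ (f : Fˣ →* Multiplicative ℤ) (x : Fˣ), f x ≠ 1 := by
  let := φ.toAlgebra
  have : FiniteDimensional K F := hφ
  refine ⟨v.comp (Units.map (Algebra.norm K)), Units.map (φ : K →* F) t, ?_⟩
  have h : Units.map (Algebra.norm K) (Units.map (φ : K →* F) t) = t ^ Module.finrank K F :=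
    Units.ext (Algebra.norm_algebraMap (t : K))
  rw [MonoidHom.comp_apply, h, map_pow]
  exact mt (pow_eq_one_iff_left Module.finrank_pos.ne').1 ht

theorem IsIndecomposableGroup.hom_int_eq_one {G : Type u} [CommGroup G]
    (hG : IsIndecomposableGroup G) (hrank : ℵ₀ ≤ Module.rank ℤ (Additive G))
    (f : G →* Multiplicative ℤ) (x : G) : f x = 1 := by
  by_contra hx
  obtain ⟨g, hg⟩ := hG.isCyclic_of_hom f hx
  have htop : Submodule.span ℤ {Additive.ofMul g} = ⊤ := by
    rw [eq_top_iff]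
    rintro y -
    obtain ⟨n, hn⟩ := hg y.toMul
    exact Submodule.mem_span_singleton.2 ⟨n, congrArg Additive.ofMul hn⟩
  have h := rank_span_le (R := ℤ) {Additive.ofMul g}
  rw [htop, rank_top, mk_singleton] at h
  exact (hrank.trans h).not_gt one_lt_aleph0

theorem MvPolynomial.exists_hom_int_ne_one {k S K : Type*} [Field k] [Nonempty S] [Field K]
    [Algebra (MvPolynomial S k) K] [IsFractionRing (MvPolynomial S k) K] :
    ∃ (v : Kˣ →* Multiplicative ℤ) (t : Kˣ), v t ≠ 1 := by
  obtain ⟨v, hv⟩ := IsFractionRing.exists_hom_int_of_degree (K := K)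
    (MvPolynomial.totalDegree : MvPolynomial S k → ℕ)
    fun a b => MvPolynomial.totalDegree_mul_of_isDomain
  obtain ⟨s⟩ := ‹Nonempty S›
  refine ⟨v, Units.mk0 (algebraMap _ K (MvPolynomial.X s : MvPolynomial S k))
    (by simp [MvPolynomial.X_ne_zero]), ?_⟩
  rw [hv (MvPolynomial.X s) _ rfl, MvPolynomial.totalDegree_X]
  decide

theorem RatFunc.exists_hom_int_ne_one {k : Type*} [Field k] :
    ∃ (v : (RatFunc k)ˣ →* Multiplicative ℤ) (t : (RatFunc k)ˣ), v t ≠ 1 := by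
  obtain ⟨v, hv⟩ := IsFractionRing.exists_hom_int_of_degree (K := RatFunc k)
    (Polynomial.natDegree : Polynomial k → ℕ) fun a b => Polynomial.natDegree_mul
  refine ⟨v, Units.mk0 (algebraMap (Polynomial k) (RatFunc k) Polynomial.X)
    (by rw [RatFunc.algebraMap_X]; exact RatFunc.X_ne_zero), ?_⟩
  rw [hv Polynomial.X _ rfl, Polynomial.natDegree_X]
  decide

/-! ### The rank of the multiplicative group -/

theorem infinite_irreducible_polynomial (k : Type*) [Field k] :
    Infinite {p : Polynomial k // Irreducible p} := by
  by_contra h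
  rw [not_infinite_iff_finite] at h
  -- each element of an algebraic closure is a root of one of finitely many polynomials
  have : Set.Finite (⋃ p : {p : Polynomial k // Irreducible p},
      {x : AlgebraicClosure k | Polynomial.aeval x p.1 = 0}) :=
    Set.finite_iUnion fun p => by
      refine (p.1.rootSet_finite (AlgebraicClosure k)).subset fun x hx => ?_
      exact Polynomial.mem_rootSet.2 ⟨p.2.ne_zero, hx⟩
  have huniv : Set.Finite (Set.univ : Set (AlgebraicClosure k)) := this.subset fun x _ =>
    Set.mem_iUnion.2 ⟨⟨minpoly k x, minpoly.irreducible (Algebra.IsIntegral.isIntegral x)⟩,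
      minpoly.aeval k x⟩
  have : Finite (AlgebraicClosure k) := Set.finite_univ_iff.1 huniv
  exact not_finite (AlgebraicClosure k)

/-- The irreducible polynomials in `t` over `𝔽₂` are multiplicatively independent. -/
theorem Transcendental.aleph0_le_rank_units {F : Type u} [Field F] [Algebra (ZMod 2) F] {t : F}
    (ht : Transcendental (ZMod 2) t) : ℵ₀ ≤ Module.rank ℤ (Additive Fˣ) := by
  let R := Polynomial (ZMod 2)
  let K := FractionRing R
  let ι := {p : R // Irreducible p}
  have : Infinite ι := infinite_irreducible_polynomial _
  have hinj : Function.Injective (Polynomial.aeval t : R →ₐ[ZMod 2] F) :=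
    transcendental_iff_injective.1 ht
  have hfin : ∀ (p : ι) (a : R), a ≠ 0 → FiniteMultiplicity p.1 a := fun p a ha =>
    FiniteMultiplicity.of_prime_left p.2.prime ha
  choose v hv using fun p : ι => IsFractionRing.exists_hom_int_of_degree (K := K)
    (multiplicity p.1) fun a b ha hb =>
      multiplicity_mul p.2.prime (hfin p _ (mul_ne_zero ha hb))
  let e : ι → Kˣ := fun p => Units.mk0 (algebraMap R K p.1) (by simpa using p.2.ne_zero)
  let f : ι → Module.Dual ℤ (Additive Kˣ) := fun p =>
    (MonoidHom.toAdditiveLeft (v p)).toIntLinearMap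
  have hf : ∀ p q, f p (Additive.ofMul (e q)) = multiplicity p.1 q.1 := fun p q =>
    congrArg Multiplicative.toAdd (hv p q.1 (e q) rfl)
  have hli : LinearIndependent ℤ fun p => Additive.ofMul (e p) := by
    refine LinearIndependent.of_pairwise_dual_eq_zero_one _ f (fun p q hpq => ?_) fun p => ?_
    · change f p (Additive.ofMul (e q)) = 0
      rw [hf, Nat.cast_eq_zero, multiplicity_eq_zero]
      refine fun hdvd => hpq (Subtype.ext ?_)
      -- over `𝔽₂` every irreducible polynomial is monic
      have hmonic : ∀ r : ι, r.1.Monic := fun r => by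
        have h01 : ∀ a : ZMod 2, a ≠ 0 → a = 1 := by decide
        exact h01 _ (Polynomial.leadingCoeff_ne_zero.2 r.2.ne_zero)
      exact Polynomial.eq_of_monic_of_associated (hmonic p) (hmonic q)
        (p.2.associated_of_dvd q.2 hdvd)
    · rw [hf]
      exact_mod_cast multiplicity_self
  let i : Kˣ →* Fˣ := Units.map (IsFractionRing.lift (A := R) (K := K)
    (g := (Polynomial.aeval t : R →ₐ[ZMod 2] F).toRingHom) hinj : K →* F)
  have hi : Function.Injective i := Units.map_injective (RingHom.injective _)
  have hli' := hli.map' (MonoidHom.toAdditive i).toIntLinearMap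
    (LinearMap.ker_eq_bot.2 hi)
  exact hli'.aleph0_le_rank

/-! ### Extensions generated in bounded degree -/

section BoundedDegree

variable {K : Type v} {F : Type u} [Field K] [Field F] [Algebra K F]

open IntermediateField

/-- The inseparable degree `2 ^ m` of `x` is at most `d`, so that `m ≤ d`. -/
theorem IsAlgebraic.pow_two_pow_mem_separableClosure [CharP K 2] {x : F} (hx : IsAlgebraic K x)
    {d : ℕ} (hd : (minpoly K x).natDegree ≤ d) : x ^ 2 ^ d ∈ separableClosure K F := by
  have := ExpChar.prime (R := K) Nat.prime_two
  obtain ⟨g, hg, m, hgm⟩ := (minpoly.irreducible hx.isIntegral).hasSeparableContraction 2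
  have hm : m ≤ d := by
    have hg0 : g.natDegree ≠ 0 := fun h => by
      have := minpoly.natDegree_pos hx.isIntegral
      rw [← hgm, Polynomial.natDegree_expand, h] at this
      omega
    rw [← hgm, Polynomial.natDegree_expand] at hd
    calc m ≤ 2 ^ m := Nat.lt_two_pow_self.le
      _ ≤ g.natDegree * 2 ^ m := Nat.le_mul_of_pos_left _ (Nat.pos_of_ne_zero hg0)
      _ ≤ d := hd
  have hsep : x ^ 2 ^ m ∈ separableClosure K F := by
    rw [mem_separableClosure_iff]
    refine hg.of_dvd (minpoly.dvd K _ ?_)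
    rw [← Polynomial.expand_aeval, hgm, minpoly.aeval]
  rw [← Nat.add_sub_cancel' hm, pow_add, pow_mul]
  exact pow_mem hsep _

theorem pow_two_pow_mem_separableClosure_of_adjoin_eq_top [CharP K 2]
    {S : Set F} {d : ℕ} (hS : ∀ x ∈ S, IsAlgebraic K x ∧ (minpoly K x).natDegree ≤ d)
    (htop : adjoin K S = ⊤) (a : F) : a ^ 2 ^ d ∈ separableClosure K F := by
  have : CharP F 2 := charP_of_injective_algebraMap (algebraMap K F).injective 2
  have ha : a ∈ adjoin K S := htop ▸ mem_top
  induction ha using adjoin_induction with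
  | mem x hx => exact (hS x hx).1.pow_two_pow_mem_separableClosure (hS x hx).2
  | algebraMap x => rw [← map_pow]; exact IntermediateField.algebraMap_mem _ _
  | add x y _ _ hx hy => rw [add_pow_char_pow]; exact add_mem hx hy
  | inv x _ hx => rw [inv_pow]; exact inv_mem hx
  | mul x y _ _ hx hy => rw [mul_pow]; exact mul_mem hx hy

/-- An automorphism over `K` permutes the at most `d` conjugates of an element of degree at most
`d`, so its `d!`-th power fixes the element. -/
theorem AlgEquiv.pow_factorial_apply_eq_self {L : Type*} [Field L] [Algebra K L] (τ : L ≃ₐ[K] L)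
    {x : L} (hx : IsIntegral K x) {d : ℕ} (hd : (minpoly K x).natDegree ≤ d) :
    (τ ^ d.factorial) x = x := by
  classical
  have hmaps : ∀ i ∈ Finset.range (d + 1), (τ ^ i) x ∈ ((minpoly K x).aroots L).toFinset :=
    fun i _ => by
      rw [Multiset.mem_toFinset, Polynomial.mem_aroots]
      exact ⟨minpoly.ne_zero hx, by
        have := Polynomial.aeval_algHom_apply ((τ ^ i : L ≃ₐ[K] L) : L →ₐ[K] L) x (minpoly K x)
        rwa [minpoly.aeval, map_zero] at this⟩
  have hcard : ((minpoly K x).aroots L).toFinset.card < (Finset.range (d + 1)).card := by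
    rw [Finset.card_range, Nat.lt_succ_iff]
    refine (Multiset.toFinset_card_le _).trans ((Polynomial.card_roots' _).trans ?_)
    exact (Polynomial.natDegree_map_le).trans hd
  obtain ⟨i, hi, j, hj, hij, h⟩ := Finset.exists_ne_map_eq_of_card_lt_of_maps_to hcard hmaps
  have key : ∀ i j, i < j → j ≤ d → (τ ^ i) x = (τ ^ j) x → (τ ^ d.factorial) x = x := by
    intro i j hij hj h
    have h1 : (τ ^ (j - i)) x = x := by
      apply (τ ^ i).injective
      rw [← AlgEquiv.mul_apply, ← pow_add, Nat.add_sub_cancel' hij.le, h]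
    obtain ⟨c, hc⟩ := Nat.dvd_factorial (m := j - i) (n := d) (by omega) (by omega)
    rw [hc, pow_mul]
    have h2 : Function.IsFixedPt (⇑(τ ^ (j - i))) x := h1
    rw [AlgEquiv.coe_pow]
    exact h2.iterate c
  rw [Finset.mem_range] at hi hj
  obtain hlt | hlt := lt_or_gt_of_ne hij
  · exact key i j hlt (by omega) h
  · exact key j i hlt (by omega) h.symm

/-- If `F` has no nontrivial roots of unity, then a root of unity and its square are conjugate over
every subfield `K` of `F`: the coefficients of the minimal polynomial are algebraic over `𝔽₂`, hence
in `𝔽₂` and fixed by the Frobenius. -/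
theorem isConjRoot_sq_of_pow_eq_one [Algebra (ZMod 2) F] [IsMulTorsionFree Fˣ] [CharP K 2]
    {L : Type*} [Field L] [Algebra K L] {ζ : L} {m : ℕ} (hm : m ≠ 0) (hζ : ζ ^ m = 1) :
    IsConjRoot K ζ (ζ ^ 2) := by
  have : CharP L 2 := charP_of_injective_algebraMap (algebraMap K L).injective 2
  have : CharP F 2 := charP_of_injective_algebraMap (algebraMap K F).injective 2
  let : Algebra (ZMod 2) K := ZMod.algebra K 2
  have : IsScalarTower (ZMod 2) K F := IsScalarTower.of_algebraMap_eq' (Subsingleton.elim _ _)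
  have hint : IsIntegral K ζ := IsIntegral.of_pow (Nat.pos_of_ne_zero hm) (by rw [hζ]; exact isIntegral_one)
  have hcoeff : ∀ i, (minpoly K ζ).coeff i ^ 2 = (minpoly K ζ).coeff i := fun i => by
    have h1 : IsIntegral (ZMod 2) ((minpoly K ζ).coeff i) := by
      refine Polynomial.isIntegral_coeff_of_dvd (Polynomial.X ^ m - 1 : Polynomial (ZMod 2)) _
        (Polynomial.monic_X_pow_sub_C 1 hm) (minpoly.monic hint) (minpoly.dvd K ζ ?_) i
      simp [hζ]
    have h2 : algebraMap K F ((minpoly K ζ).coeff i) ^ 2 =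
        algebraMap K F ((minpoly K ζ).coeff i) := by
      obtain h | h := eq_zero_or_one_of_isAlgebraic_of_isMulTorsionFree_units
        (h1.map (IsScalarTower.toAlgHom (ZMod 2) K F)).isAlgebraic
      · simp only [IsScalarTower.coe_toAlgHom'] at h; simp [h]
      · simp only [IsScalarTower.coe_toAlgHom'] at h; simp [h]
    rw [← map_pow] at h2
    exact (algebraMap K F).injective h2
  have hfrob : (minpoly K ζ).map (frobenius K 2) = minpoly K ζ := by
    ext i
    rw [Polynomial.coeff_map, frobenius_def, hcoeff]
  rw [isConjRoot_iff_aeval_eq_zero hint]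
  have h := congrArg (frobenius L 2) (minpoly.aeval K ζ)
  rw [Polynomial.aeval_def, Polynomial.hom_eval₂, map_zero, ← RingHom.frobenius_comm,
    ← Polynomial.eval₂_map, hfrob] at h
  exact h

/-- The degree bound behind the third assertion. Let `F / K` be generated in degree at most `d`, with
no nontrivial roots of unity in `F`, and let `a ∈ F` be separable over `K` with a power in `E`. With
`m` the degree of `a` over `E`, comparing norms gives `a ^ m ∈ E`, so `m` is odd and the conjugates of
`a` over `E` are its products with the `m`-th roots of unity. As `d!`-th powers of automorphisms over
`K` fix all conjugates of elements of `F`, they fix these roots of unity; applied to an automorphism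
squaring them, this shows that `m` divides `2 ^ d! - 1`. -/
theorem natDegree_minpoly_le_of_pow_mem [Algebra (ZMod 2) F] [IsMulTorsionFree Fˣ]
    [CharP K 2] [Algebra.IsAlgebraic K F]
    {S : Set F} {d : ℕ} (hS : ∀ x ∈ S, (minpoly K x).natDegree ≤ d)
    (htop : adjoin K S = ⊤) (E : IntermediateField K F) {a : F} (ha0 : a ≠ 0)
    (ha : a ∈ separableClosure K F) {n : ℕ} (hn : n ≠ 0) (han : a ^ n ∈ E) :
    (minpoly E a).natDegree ≤ 2 ^ d.factorial := by
  have : CharP F 2 := charP_of_injective_algebraMap (algebraMap K F).injective 2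
  have : CharP E 2 := charP_of_injective_algebraMap (algebraMap K E).injective 2
  let L := AlgebraicClosure F
  have : CharP L 2 := charP_of_injective_algebraMap (algebraMap F L).injective 2
  have hint : IsIntegral E a := Algebra.IsIntegral.isIntegral a
  set m := (minpoly E a).natDegree with hm
  have hm0 : m ≠ 0 := (minpoly.natDegree_pos hint).ne'
  -- the norm of `a` and `a ^ m` have the same `n`-th power, and `F` has no roots of unity
  obtain ⟨c, hc⟩ : ∃ c : E, (c : F) = a ^ m := by
    have : FiniteDimensional E E⟮a⟯ := adjoin.finiteDimensional hint
    let a' : E⟮a⟯ := ⟨a, mem_adjoin_simple_self E a⟩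
    let b : E := ⟨a ^ n, han⟩
    refine ⟨Algebra.norm E a', ?_⟩
    have h1 : a' ^ n = algebraMap E E⟮a⟯ b := Subtype.ext rfl
    have h2 : (Algebra.norm E a') ^ n = b ^ m := by
      rw [← map_pow, h1, Algebra.norm_algebraMap, adjoin.finrank hint]
    have h3 : ((Algebra.norm E a' : E) : F) ^ n = (a ^ m) ^ n := by
      rw [← SubmonoidClass.coe_pow, h2, pow_right_comm]
      rfl
    have h4 : ((Algebra.norm E a' : E) : F) ≠ 0 := fun h => by
      rw [h, zero_pow hn] at h3
      exact pow_ne_zero n (pow_ne_zero m ha0) h3.symm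
    have h5 : (Units.mk0 _ h4) ^ n = (Units.mk0 a ha0 ^ m) ^ n := Units.ext h3
    exact congrArg Units.val (pow_left_injective hn h5)
  have hminpoly : minpoly E a = Polynomial.X ^ m - Polynomial.C c := by
    symm
    refine Polynomial.eq_of_monic_of_dvd_of_natDegree_le (minpoly.monic hint)
      (Polynomial.monic_X_pow_sub_C c hm0) (minpoly.dvd E a ?_) ?_
    · simp [← hc, IntermediateField.algebraMap_apply]
    · rw [Polynomial.natDegree_X_pow_sub_C]
  have hm2 : ¬ 2 ∣ m := fun h2 => by
    have hsep : (minpoly E a).Separable := by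
      have : IsSeparable K a := mem_separableClosure_iff.1 ha
      exact this.tower_top E
    have hmE : (m : E) = 0 := (CharP.cast_eq_zero_iff E 2 m).2 h2
    rw [Polynomial.separable_iff_derivative_ne_zero (minpoly.irreducible hint), hminpoly] at hsep
    exact hsep (by rw [Polynomial.derivative_sub, Polynomial.derivative_X_pow, hmE]; simp)
  have : NeZero (m : L) := ⟨fun h => hm2 ((CharP.cast_eq_zero_iff L 2 m).1 h)⟩
  obtain ⟨ζ, hζ⟩ := HasEnoughRootsOfUnity.exists_primitiveRoot L m
  -- `ζ` is a quotient of conjugates of `a` over `E`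
  have : Algebra.IsAlgebraic K L := Algebra.IsAlgebraic.trans K F L
  have : IsAlgClosure K L := ⟨inferInstance, inferInstance⟩
  have : Normal K L := IsAlgClosure.normal K L
  obtain ⟨σ, hσ⟩ : ∃ σ : L ≃ₐ[E] L, σ (algebraMap F L a) = algebraMap F L a * ζ := by
    have : Algebra.IsAlgebraic E L := Algebra.IsAlgebraic.tower_top (K := K) E
    have : IsAlgClosure E L := ⟨inferInstance, inferInstance⟩
    have : Normal E L := IsAlgClosure.normal E L
    refine isConjRoot_iff_exists_algEquiv.1 (IsConjRoot.symm ?_)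
    have hc' : algebraMap E L c = algebraMap F L a ^ m := by
      rw [← map_pow, ← hc]
      rfl
    rw [isConjRoot_iff_aeval_eq_zero hint.algebraMap, minpoly.algebraMap_eq
      (algebraMap F L).injective, hminpoly]
    simp [mul_pow, hζ.pow_eq_one, hc']
  have hfix : ∀ (τ : L ≃ₐ[K] L) (x : F),
      (τ ^ d.factorial) (algebraMap F L x) = algebraMap F L x := fun τ x => by
    have hx : x ∈ adjoin K S := htop ▸ mem_top
    induction hx using adjoin_induction with
    | mem x hx =>
      refine τ.pow_factorial_apply_eq_self (Algebra.IsIntegral.isIntegral _) ?_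
      rw [minpoly.algebraMap_eq (algebraMap F L).injective]
      exact hS x hx
    | algebraMap x => rw [← IsScalarTower.algebraMap_apply, AlgEquiv.commutes]
    | add x y _ _ hx hy => rw [map_add, map_add, hx, hy]
    | inv x _ hx => rw [map_inv₀, map_inv₀, hx]
    | mul x y _ _ hx hy => rw [map_mul, map_mul, hx, hy]
  -- an automorphism acting on `ζ` as the Frobenius
  obtain ⟨τ, hτ⟩ : ∃ τ : L ≃ₐ[K] L, τ ζ = ζ ^ 2 :=
    isConjRoot_iff_exists_algEquiv.1
      (isConjRoot_sq_of_pow_eq_one (F := F) hm0 hζ.pow_eq_one).symm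
  have hτk : ∀ k : ℕ, (τ ^ k) ζ = ζ ^ 2 ^ k := fun k => by
    induction k with
    | zero => simp
    | succ k ih => rw [pow_succ', AlgEquiv.mul_apply, ih, map_pow, hτ, ← pow_mul, pow_succ']
  -- the conjugate `σ a` is fixed because a conjugate of `τ` fixes `a`
  let ρ : L ≃ₐ[K] L := σ.restrictScalars K
  have hσfix : (τ ^ d.factorial) (ρ (algebraMap F L a)) = ρ (algebraMap F L a) := by
    have h := hfix (ρ⁻¹ * τ * ρ) a
    rw [show ρ⁻¹ * τ * ρ = ρ⁻¹ * τ * (ρ⁻¹)⁻¹ by rw [inv_inv], conj_pow, inv_inv,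
      AlgEquiv.mul_apply, AlgEquiv.mul_apply] at h
    have h' := congrArg ρ h
    rwa [← AlgEquiv.mul_apply ρ, mul_inv_cancel, AlgEquiv.one_apply] at h'
  have hζfix : (τ ^ d.factorial) ζ = ζ := by
    have hρ : ρ (algebraMap F L a) = algebraMap F L a * ζ := hσ
    rw [hρ, map_mul, hfix] at hσfix
    exact mul_left_cancel₀ (by simpa using ha0) hσfix
  rw [hτk] at hζfix
  have hdvd : m ∣ 2 ^ d.factorial - 1 := by
    refine hζ.dvd_of_pow_eq_one _ (mul_right_cancel₀ (hζ.ne_zero hm0) ?_)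
    rw [← pow_succ, Nat.sub_add_cancel Nat.one_le_two_pow, hζfix, one_mul]
  have h1 : 2 ≤ 2 ^ d.factorial := by
    simpa using Nat.pow_le_pow_right two_pos (Nat.one_le_iff_ne_zero.2 d.factorial_ne_zero)
  exact (Nat.le_of_dvd (by omega) hdvd).trans (Nat.sub_le _ _)

end BoundedDegree

/-! ### Finiteness of roots of bounded degree -/

/-- If `u * a` is integral over `A`, then so are the coefficients of the minimal polynomial of `a` with
its roots scaled by `u`. -/
theorem IsIntegral.coeff_minpoly_mul_pow {A K F : Type*} [CommRing A] [Field K] [Field F]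
    [Algebra A K] [Algebra K F] [Algebra A F] [IsScalarTower A K F] {u : K} (hu : u ≠ 0) {a : F}
    (ha : IsIntegral K a) (h : IsIntegral A (algebraMap K F u * a)) (j : ℕ) :
    IsIntegral A ((minpoly K a).coeff j * u ^ ((minpoly K a).natDegree - j)) := by
  obtain ⟨q, hq, hqa⟩ := h
  have hdvd : (minpoly K a).scaleRoots u ∣ q.map (algebraMap A K) := by
    have h1 : minpoly K a ∣ (q.map (algebraMap A K)).scaleRoots u⁻¹ := by
      apply minpoly.dvd
      have h2 : Polynomial.aeval (algebraMap K F u * a) (q.map (algebraMap A K)) = 0 := by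
        rwa [Polynomial.aeval_map_algebraMap]
      have h3 := Polynomial.scaleRoots_aeval_eq_zero (r := u⁻¹) h2
      rwa [← mul_assoc, ← map_mul, inv_mul_cancel₀ hu, map_one, one_mul] at h3
    have h4 := Polynomial.scaleRoots_dvd _ _ (r := u) h1
    rwa [← Polynomial.scaleRoots_mul, inv_mul_cancel₀ hu, Polynomial.scaleRoots_one] at h4
  rw [← Polynomial.coeff_scaleRoots]
  exact Polynomial.isIntegral_coeff_of_dvd q _ hq
    ((Polynomial.monic_scaleRoots_iff u).2 (minpoly.monic ha)) hdvd j

/-- A common denominator `c` of the `x i` gives the denominator `c ^ s.card` of all `a` with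
`a ^ n` a product of the `x i` with exponents at most `n`, uniformly in `n`. -/
theorem IsIntegral.pow_card_mul_of_pow_eq_prod {A F ι : Type*} [CommRing A] [Field F] [Algebra A F]
    (s : Finset ι) (x : ι → F) {c : A} (hc : ∀ i ∈ s, IsIntegral A (c • x i)) {a : F} {n : ℕ}
    (hn : n ≠ 0) {e : ι → ℕ} (he : ∀ i ∈ s, e i ≤ n) (ha : a ^ n = ∏ i ∈ s, x i ^ e i) :
    IsIntegral A (c ^ s.card • a) := by
  refine IsIntegral.of_pow (Nat.pos_of_ne_zero hn) ?_
  have h : (c ^ s.card • a) ^ n =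
      ∏ i ∈ s, algebraMap A F c ^ (n - e i) * (c • x i) ^ e i := by
    rw [Algebra.smul_def, mul_pow, ha, map_pow, pow_right_comm, ← Finset.prod_const,
      ← Finset.prod_mul_distrib]
    refine Finset.prod_congr rfl fun i hi => ?_
    rw [Algebra.smul_def, mul_pow, ← mul_assoc, ← pow_add, Nat.sub_add_cancel (he i hi)]
  rw [h]
  exact IsIntegral.prod _ fun i hi => (isIntegral_algebraMap.pow _).mul ((hc i hi).pow _)

open scoped NNReal in
/-- The valuation `f ↦ 2 ^ deg f` on the field of rational functions. -/
theorem MvPolynomial.exists_valuation_eq_two_pow_totalDegree {σ k K : Type*} [Field k] [Field K]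
    [Algebra (MvPolynomial σ k) K] [IsFractionRing (MvPolynomial σ k) K] :
    ∃ w : Valuation K ℝ≥0, ∀ f : MvPolynomial σ k, f ≠ 0 →
      w (algebraMap _ K f) = 2 ^ f.totalDegree := by
  classical
  let v : Valuation (MvPolynomial σ k) ℝ≥0 :=
    { toFun f := if f = 0 then 0 else 2 ^ f.totalDegree
      map_zero' := by simp
      map_one' := by simp
      map_mul' f g := by
        by_cases hf : f = 0
        · simp [hf]
        by_cases hg : g = 0
        · simp [hg]
        simp [hf, hg, MvPolynomial.totalDegree_mul_of_isDomain hf hg, pow_add]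
      map_add_le_max' f g := by
        by_cases hf : f = 0
        · simp [hf]
        by_cases hg : g = 0
        · simp [hg]
        by_cases hfg : f + g = 0
        · simp [hfg]
        simp only [hf, hg, hfg, if_false]
        obtain h | h := le_max_iff.1 (MvPolynomial.totalDegree_add f g)
        · exact le_max_of_le_left (pow_le_pow_right₀ one_le_two h)
        · exact le_max_of_le_right (pow_le_pow_right₀ one_le_two h) }
  have hv : ∀ f, f ≠ 0 → v f = 2 ^ f.totalDegree := fun f hf => if_neg hf
  have hS : nonZeroDivisors (MvPolynomial σ k) ≤ v.supp.primeCompl := fun f hf h => by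
    have h0 : v f = 0 := h
    rw [hv f (nonZeroDivisors.ne_zero hf)] at h0
    exact pow_ne_zero _ two_ne_zero h0
  exact ⟨v.extendToLocalization hS K, fun f hf => by
    rw [Valuation.extendToLocalization_apply_map_apply, hv f hf]⟩

/-- If `a ^ n` is a product of the `x i` with exponents at most `n`, the coefficients of the minimal
polynomial of `a` have denominators bounded in terms of the `x i` alone. -/
theorem exists_isIntegral_coeff_minpoly_mul_pow (A : Type*) {K F ι : Type*} [CommRing A]
    [IsDomain A] [Field K] [Field F] [Algebra A K] [IsFractionRing A K] [Algebra K F]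
    [Algebra A F] [IsScalarTower A K F] [Algebra.IsAlgebraic K F] (s : Finset ι) (x : ι → F) :
    ∃ u : K, u ≠ 0 ∧ ∀ a : F, ∀ n ≠ 0, ∀ e : ι → ℕ, (∀ i ∈ s, e i ≤ n) →
      a ^ n = ∏ i ∈ s, x i ^ e i → ∀ j, IsIntegral A ((minpoly K a).coeff j *
        u ^ ((minpoly K a).natDegree - j)) := by
  classical
  have : Algebra.IsAlgebraic A F := (IsFractionRing.comap_isAlgebraic_iff (K := K)).2 inferInstance
  have : Module.IsTorsionFree A F := Module.IsTorsionFree.trans_faithfulSMul A K F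
  obtain ⟨c, hc, h⟩ := Algebra.IsAlgebraic.exists_integral_multiples A (s.image x)
  have hc' : algebraMap A K (c ^ s.card) ≠ 0 := by simp [hc]
  refine ⟨_, hc', fun a n hn e he ha j => ?_⟩
  refine IsIntegral.coeff_minpoly_mul_pow hc' (Algebra.IsIntegral.isIntegral a) ?_ j
  rw [← IsScalarTower.algebraMap_apply, ← Algebra.smul_def]
  exact IsIntegral.pow_card_mul_of_pow_eq_prod s x
    (fun i hi => h _ (Finset.mem_image_of_mem x hi)) hn he ha

open scoped NNReal in
/-- A finiteness statement in the spirit of Northcott: the elements of bounded degree that have a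
power equal to a product of the `x i`, with exponents at most that of the power, are finite in number.
Both the denominators and the degrees (via the valuation `2 ^ deg`) of the coefficients of their
minimal polynomials are bounded, which leaves finitely many polynomials over a finite field. -/
theorem finite_setOf_pow_eq_prod_of_natDegree_le (σ k : Type*) {K F ι : Type*} [Finite σ] [Field k]
    [Finite k] [Field K] [Algebra (MvPolynomial σ k) K] [IsFractionRing (MvPolynomial σ k) K]
    [Field F] [Algebra K F] [Algebra.IsAlgebraic K F] (s : Finset ι) (x : ι → F) (N : ℕ) :
    {a : F | (minpoly K a).natDegree ≤ N ∧ ∃ n ≠ 0, ∃ e : ι → ℕ, (∀ i ∈ s, e i ≤ n) ∧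
      a ^ n = ∏ i ∈ s, x i ^ e i}.Finite := by
  classical
  obtain ⟨w, hw⟩ := MvPolynomial.exists_valuation_eq_two_pow_totalDegree (σ := σ) (k := k) (K := K)
  let : Algebra (MvPolynomial σ k) F := ((algebraMap K F).comp (algebraMap _ K)).toAlgebra
  have : IsScalarTower (MvPolynomial σ k) K F := IsScalarTower.of_algebraMap_eq' rfl
  let O := w.valuationSubring
  let : Algebra O F := ((algebraMap K F).comp (algebraMap O K)).toAlgebra
  have : IsScalarTower O K F := IsScalarTower.of_algebraMap_eq' rfl
  obtain ⟨c, hc, hcint⟩ := exists_isIntegral_coeff_minpoly_mul_pow (MvPolynomial σ k) (K := K) s x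
  obtain ⟨b, hb, hbint⟩ := exists_isIntegral_coeff_minpoly_mul_pow O (K := K) s x
  obtain ⟨M, hM⟩ := exists_nat_ge (max 1 (w b)⁻¹ ^ N * max 1 (w c) ^ N)
  let V : Set (MvPolynomial σ k) := MvPolynomial.restrictTotalDegree σ k M
  have hV : V.Finite := by
    have : Finite (MvPolynomial.restrictTotalDegree σ k M) := Module.finite_of_finite k
    exact Set.toFinite _
  let Z : Set K := ⋃ l ∈ Finset.range (N + 1), (fun f => algebraMap _ K f / c ^ l) '' V
  have hZ : Z.Finite := Set.Finite.biUnion (Finset.finite_toSet _) fun l _ => hV.image _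
  refine (Polynomial.bUnion_roots_finite (algebraMap K F) N hZ).subset ?_
  rintro a ⟨hdeg, n, hn, e, he, ha⟩
  have hint : IsIntegral K a := Algebra.IsIntegral.isIntegral a
  refine Set.mem_biUnion (x := minpoly K a) ⟨hdeg, fun j => ?_⟩ ?_
  · set l := (minpoly K a).natDegree - j with hl
    have hlN : l ≤ N := (Nat.sub_le _ _).trans hdeg
    obtain ⟨f, hf⟩ := IsIntegrallyClosed.isIntegral_iff.1 (hcint a n hn e he ha j)
    obtain ⟨g, hg⟩ := IsIntegrallyClosed.isIntegral_iff.1 (hbint a n hn e he ha j)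
    have hg1 : w ((minpoly K a).coeff j) * w b ^ l ≤ 1 := by
      rw [← map_pow, ← map_mul, ← hg]
      exact g.2
    have hbound : w ((minpoly K a).coeff j) ≤ max 1 (w b)⁻¹ ^ N := by
      have hb0 : 0 < w b ^ l := pow_pos ((Valuation.pos_iff w).2 hb) _
      calc w ((minpoly K a).coeff j) ≤ (w b)⁻¹ ^ l := by
            rw [inv_pow, ← one_div, le_div_iff₀ hb0]
            exact hg1
        _ ≤ max 1 (w b)⁻¹ ^ l := pow_le_pow_left₀ zero_le (le_max_right _ _) _
        _ ≤ _ := pow_le_pow_right₀ (le_max_left _ _) hlN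
    have hfM : f ∈ V := by
      change f ∈ MvPolynomial.restrictTotalDegree σ k M
      rw [MvPolynomial.mem_restrictTotalDegree]
      by_cases hf0 : f = 0
      · simp [hf0]
      have h1 : (2 : ℝ≥0) ^ f.totalDegree ≤ M := by
        rw [← hw f hf0, hf, map_mul, map_pow]
        refine (mul_le_mul' hbound ?_).trans hM
        exact (pow_le_pow_left₀ zero_le (le_max_right _ _) _).trans
          (pow_le_pow_right₀ (le_max_left _ _) hlN)
      have h2 : 2 ^ f.totalDegree ≤ M := by exact_mod_cast h1
      exact Nat.lt_two_pow_self.le.trans h2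
    refine Set.mem_biUnion (x := l) (by simpa using Nat.lt_succ_of_le hlN) ⟨f, hfM, ?_⟩
    change algebraMap _ K f / c ^ l = _
    rw [hf, mul_div_cancel_right₀ _ (pow_ne_zero _ hc)]
  · simp only [Finset.mem_coe, Multiset.mem_toFinset]
    exact Polynomial.mem_aroots.2 ⟨minpoly.ne_zero hint, minpoly.aeval K a⟩

/-! ### Homomorphisms to the integers in bounded degree -/

/-- If the elements dividing a nonnegative combination with coefficients at most the divisor form a
finite set, then the pure closure of the span is finitely generated. -/
theorem Submodule.exists_fg_pure_closure {M : Type*} [AddCommGroup M] (s : Finset M)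
    (hfin : {a : M | ∃ n ≠ 0, ∃ e : M → ℕ, (∀ i ∈ s, e i ≤ n) ∧
      n • a = ∑ i ∈ s, e i • i}.Finite) :
    ∃ Q : Submodule ℤ M, Q.FG ∧
      ∀ x, x ∈ Q ↔ ∃ n : ℤ, n ≠ 0 ∧ n • x ∈ Submodule.span ℤ (s : Set M) := by
  classical
  set W := {a : M | ∃ n ≠ 0, ∃ e : M → ℕ, (∀ i ∈ s, e i ≤ n) ∧ n • a = ∑ i ∈ s, e i • i}
  refine ⟨Submodule.span ℤ (s ∪ W), Submodule.fg_span (s.finite_toSet.union hfin), fun x => ?_⟩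
  constructor
  · intro hx
    induction hx using Submodule.span_induction with
    | mem x hx =>
      obtain hx | ⟨n, hn, e, -, he⟩ := hx
      · exact ⟨1, one_ne_zero, by simpa using Submodule.subset_span hx⟩
      · refine ⟨n, by exact_mod_cast hn, ?_⟩
        rw [natCast_zsmul, he]
        exact Submodule.sum_mem _ fun i hi =>
          (Submodule.span ℤ (s : Set M)).toAddSubgroup.nsmul_mem (Submodule.subset_span hi) _
    | zero => exact ⟨1, one_ne_zero, by simp⟩
    | add x y _ _ hx hy =>
      obtain ⟨m, hm, hmx⟩ := hx
      obtain ⟨n, hn, hny⟩ := hy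
      refine ⟨m * n, mul_ne_zero hm hn, ?_⟩
      rw [smul_add]
      refine add_mem ?_ ?_
      · rw [mul_comm, mul_smul]
        exact Submodule.smul_mem _ _ hmx
      · rw [mul_smul]
        exact Submodule.smul_mem _ _ hny
    | smul c x _ hx =>
      obtain ⟨m, hm, hmx⟩ := hx
      exact ⟨m, hm, by rw [smul_comm]; exact Submodule.smul_mem _ _ hmx⟩
  · rintro ⟨m, hm, hmx⟩
    obtain ⟨n, hn, hnx⟩ : ∃ n : ℕ, n ≠ 0 ∧ n • x ∈ Submodule.span ℤ (s : Set M) := by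
      refine ⟨m.natAbs, by simpa using hm, ?_⟩
      rw [← natCast_zsmul]
      obtain h | h := Int.natAbs_eq m
      · rwa [← h]
      · rw [← neg_mem_iff, ← neg_smul, ← h]
        exact hmx
    obtain ⟨f, -, hf⟩ := Submodule.mem_span_finset.1 hnx
    have hn' : (n : ℤ) ≠ 0 := by exact_mod_cast hn
    -- reduce the exponents modulo `n`
    have hb : x - ∑ i ∈ s, (f i / n) • i ∈ W := by
      refine ⟨n, hn, fun i => (f i % n).toNat, fun i _ => ?_, ?_⟩
      · have := Int.emod_lt_of_pos (f i) (show (0 : ℤ) < n by omega)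
        change (f i % n).toNat ≤ n
        omega
      · rw [smul_sub, ← hf, Finset.smul_sum, ← Finset.sum_sub_distrib]
        refine Finset.sum_congr rfl fun i _ => ?_
        rw [← natCast_zsmul, ← natCast_zsmul, ← mul_smul, ← sub_smul,
          Int.toNat_of_nonneg (Int.emod_nonneg _ hn')]
        congr 1
        have := Int.emod_add_mul_ediv (f i) n
        linarith
    have := add_mem (Submodule.subset_span (R := ℤ) (Set.mem_union_right (s : Set M) hb))
      (Submodule.sum_mem _ fun i (hi : i ∈ s) => Submodule.smul_mem _ (f i / n)
        (Submodule.subset_span (R := ℤ) (Set.mem_union_left W (Finset.mem_coe.2 hi))))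
    rwa [sub_add_cancel] at this

section

variable {F : Type u} [Field F] [Algebra (ZMod 2) F] [IsMulTorsionFree Fˣ]

open IntermediateField

/-- The finiteness hypothesis of `Submodule.exists_fg_pure_closure` for unit groups of extensions
generated in bounded degree. -/
theorem finite_setOf_nsmul_eq_sum_units (σ k : Type*) {K : Type v} [Field K] [Finite σ] [Field k]
    [Finite k] [Algebra (MvPolynomial σ k) K] [IsFractionRing (MvPolynomial σ k) K] [Algebra K F]
    [CharP K 2]
    [Algebra.IsAlgebraic K F] {S : Set F} {d : ℕ} (hS : ∀ x ∈ S, (minpoly K x).natDegree ≤ d)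
    (htop : adjoin K S = ⊤) (s : Finset (Additive Fˣ)) :
    {a : Additive Fˣ | ∃ n ≠ 0, ∃ e : Additive Fˣ → ℕ, (∀ i ∈ s, e i ≤ n) ∧
      n • a = ∑ i ∈ s, e i • i}.Finite := by
  let E : IntermediateField K F := adjoin K ((fun i : Additive Fˣ => (i.toMul : F)) '' s)
  have hE : FiniteDimensional K E := finiteDimensional_adjoin fun x _ => Algebra.IsIntegral.isIntegral x
  have hxE : ∀ i ∈ s, (i.toMul : F) ∈ E := fun i hi => subset_adjoin K _ ⟨i, hi, rfl⟩
  -- a fixed power of two makes all elements separable, so that their degrees are bounded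
  refine Set.Finite.of_finite_image (f := fun a : Additive Fˣ => (a.toMul : F) ^ 2 ^ d)
    ((finite_setOf_pow_eq_prod_of_natDegree_le σ k (K := K) s
      (fun i : Additive Fˣ => (i.toMul : F) ^ 2 ^ d)
      (Module.finrank K E * 2 ^ d.factorial)).subset ?_) fun a _ b _ h => ?_
  · rintro _ ⟨a, ⟨n, hn, e, he, ha⟩, rfl⟩
    have ha' : (a.toMul : F) ^ n = ∏ i ∈ s, (i.toMul : F) ^ e i := by
      have := congrArg (fun x : Additive Fˣ => (x.toMul : F)) ha
      simpa [toMul_sum, toMul_nsmul, Units.coe_prod] using this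
    have hpow : ((a.toMul : F) ^ 2 ^ d) ^ n = ∏ i ∈ s, ((i.toMul : F) ^ 2 ^ d) ^ e i := by
      rw [pow_right_comm, ha', ← Finset.prod_pow]
      exact Finset.prod_congr rfl fun i _ => pow_right_comm _ _ _
    refine ⟨?_, n, hn, e, he, hpow⟩
    set y := (a.toMul : F) ^ 2 ^ d with hy
    have hyE : y ^ n ∈ E := by
      rw [hpow]
      exact prod_mem fun i hi => pow_mem (pow_mem (hxE i hi) _) _
    have hle := natDegree_minpoly_le_of_pow_mem hS htop E (a := y) (pow_ne_zero _ a.toMul.ne_zero)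
      (pow_two_pow_mem_separableClosure_of_adjoin_eq_top
        (fun x hx => ⟨Algebra.IsAlgebraic.isAlgebraic x, hS x hx⟩) htop _) hn hyE
    have hint : IsIntegral E y := Algebra.IsIntegral.isIntegral y
    have : FiniteDimensional E E⟮y⟯ := adjoin.finiteDimensional hint
    have : IsScalarTower K E⟮y⟯ F := IsScalarTower.of_algebraMap_eq fun _ => rfl
    have : FiniteDimensional K E⟮y⟯ := FiniteDimensional.trans K E E⟮y⟯
    calc (minpoly K y).natDegree = (minpoly K (AdjoinSimple.gen E y)).natDegree := by
          rw [← minpoly.algebraMap_eq (algebraMap E⟮y⟯ F).injective, AdjoinSimple.algebraMap_gen]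
      _ ≤ Module.finrank K E⟮y⟯ := minpoly.natDegree_le _
      _ = Module.finrank K E * (minpoly E y).natDegree := by
          rw [← Module.finrank_mul_finrank K E E⟮y⟯, adjoin.finrank hint]
      _ ≤ _ := Nat.mul_le_mul_left _ hle
  · have h' : a.toMul ^ 2 ^ d = b.toMul ^ 2 ^ d := Units.ext h
    exact Additive.toMul.injective (pow_left_injective (pow_ne_zero d two_ne_zero) h')

/-- An extension of a rational function field in finitely many variables over a finite field that is
generated in bounded degree has many homomorphisms from its unit group to `ℤ`, although it need not
carry a discrete valuation. -/
theorem exists_hom_int_ne_one_of_bounded_degree (σ k : Type*) {K : Type v} [Field K] [Finite σ]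
    [Field k] [Finite k] [Algebra (MvPolynomial σ k) K] [IsFractionRing (MvPolynomial σ k) K]
    [Algebra K F] [CharP K 2]
    [Algebra.IsAlgebraic K F] {S : Set F} {d : ℕ} (hS : ∀ x ∈ S, (minpoly K x).natDegree ≤ d)
    (htop : adjoin K S = ⊤) {x : Fˣ} (hx : x ≠ 1) : ∃ f : Fˣ →* Multiplicative ℤ, f x ≠ 1 := by
  have : Countable (MvPolynomial σ k) := by
    rw [← Cardinal.mk_le_aleph0_iff]
    refine MvPolynomial.cardinalMk_le_max_lift.trans ?_
    simp [Cardinal.mk_le_aleph0]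
  have : Countable K := 
    (IsLocalization.mk'_surjective (nonZeroDivisors (MvPolynomial σ k)) (S := K)).countable
  have : Countable F := by
    have := Algebra.IsAlgebraic.lift_cardinalMk_le_max K F
    rwa [max_eq_right (by rw [lift_le_aleph0]; exact mk_le_aleph0), lift_le_aleph0,
      mk_le_aleph0_iff] at this
  have : Countable (Additive Fˣ) := Units.val_injective.countable
  obtain ⟨f, hf⟩ := Module.exists_linearForm_ne_zero_of_countable
    (fun s => Submodule.exists_fg_pure_closure s
      (finite_setOf_nsmul_eq_sum_units σ k hS htop s)) (x := Additive.ofMul x) (by simpa using hx)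
  exact ⟨AddMonoidHom.toMultiplicativeRight f.toAddMonoidHom, hf⟩

end

/-! ### Fields with indecomposable multiplicative group -/

/-- The field generated by an algebraically independent set is the fraction field of the polynomial
ring in its elements. -/
theorem AlgebraicIndependent.exists_isFractionRing_adjoin {k F : Type*} [Field k] [Field F]
    [Algebra k F] {T : Set F} (hT : AlgebraicIndependent k ((↑) : T → F)) :
    ∃ _ : Algebra (MvPolynomial T k) (IntermediateField.adjoin k T),
      IsFractionRing (MvPolynomial T k) (IntermediateField.adjoin k T) := by
  let e : FractionRing (MvPolynomial T k) ≃+* IntermediateField.adjoin k T :=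
    (hT.aevalEquivField.trans (IntermediateField.equivOfEq
      (by rw [Subtype.range_coe]))).toRingEquiv
  let : Algebra (MvPolynomial T k) (IntermediateField.adjoin k T) :=
    ((e : FractionRing (MvPolynomial T k) →+* _).comp (algebraMap _ _)).toAlgebra
  exact ⟨this, IsLocalization.isLocalization_of_algEquiv _ (AlgEquiv.ofRingEquiv (f := e)
    fun _ => rfl)⟩

theorem IsFinitelyGeneratedField.finiteDimensional {k F : Type*} [Field k] [Field F] [Algebra k F]
    [Algebra.IsAlgebraic k F] (hF : IsFinitelyGeneratedField F) : FiniteDimensional k F := by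
  obtain ⟨s, hs, htop⟩ := hF
  have h : IntermediateField.adjoin k s = ⊤ := by
    rw [eq_top_iff]
    intro x _
    have hx : x ∈ Subfield.closure s := htop ▸ Subfield.mem_top x
    exact Subfield.closure_le (t := (IntermediateField.adjoin k s).toSubfield).2
      (IntermediateField.subset_adjoin k s) hx
  have := hs.to_subtype
  have : FiniteDimensional k (IntermediateField.adjoin k s) :=
    IntermediateField.finiteDimensional_adjoin fun x _ => Algebra.IsIntegral.isIntegral x
  rw [h] at this
  exact Module.Finite.equiv (IntermediateField.topEquiv (F := k) (E := F)).toLinearEquiv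

theorem theorem3p1 (F : Type u) [Field F] [Infinite F] [Algebra (ZMod 2) F] (T : Set F)
    (hT : IsTranscendenceBasis (ZMod 2) ((↑) : T → F)) (hF : IsIndecomposableGroup Fˣ) :
    T.Nonempty ∧
    -- (1)
    (IsMulTorsionFree Fˣ ∧ ℵ₀ ≤ Module.rank ℤ (Additive Fˣ)) ∧
    -- (2)
    (Algebra.IsAlgebraic (IntermediateField.adjoin (ZMod 2) T) F ∧
      ¬ FiniteDimensional (IntermediateField.adjoin (ZMod 2) T) F ∧
      (∀ (k : Type v) [Field k] (S : Type w) [Nonempty S],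
        ¬ IsFiniteExtensionOfRationalFunctions k S F) ∧
      (∀ (k : Type v) [Field k] (n : ℕ), 1 ≤ n → ¬ IsAlgebraicFunctionField k n F) ∧
      ¬ IsGlobalField F ∧
      ¬ IsFinitelyGeneratedField F) ∧
    -- (3)
    (T.Finite →
      ¬ IsGeneratedByAlgebraicElementsOfBoundedDegree (IntermediateField.adjoin (ZMod 2) T) F) := by
  have htf : IsMulTorsionFree Fˣ := hF.isMulTorsionFree_units
  have hne : T.Nonempty := by
    by_contra! h
    have : IsEmpty T := Set.isEmpty_coe_sort.2 h
    have halg : Algebra.IsAlgebraic (ZMod 2) F := hT.isEmpty_iff_isAlgebraic.1 this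
    have : Finite F := Set.finite_univ_iff.1 ((Set.toFinite {0, 1}).subset fun x _ =>
      eq_zero_or_one_of_isAlgebraic_of_isMulTorsionFree_units (halg.isAlgebraic x))
    exact not_finite F
  obtain ⟨t, ht⟩ := hne
  have hrank : ℵ₀ ≤ Module.rank ℤ (Additive Fˣ) :=
    (hT.1.transcendental ⟨t, ht⟩).aleph0_le_rank_units
  have : Nonempty T := ⟨t, ht⟩
  have halg : Algebra.IsAlgebraic (IntermediateField.adjoin (ZMod 2) T) F := by
    have := hT.isAlgebraic_field
    rwa [Subtype.range_coe] at this
  obtain ⟨_, _⟩ := hT.1.exists_isFractionRing_adjoin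
  have hval := hF.hom_int_eq_one hrank
  have hnotfin : ¬ FiniteDimensional (IntermediateField.adjoin (ZMod 2) T) F := fun h => by
    obtain ⟨v, z, hz⟩ := MvPolynomial.exists_hom_int_ne_one (k := ZMod 2) (S := T)
      (K := IntermediateField.adjoin (ZMod 2) T)
    obtain ⟨f, x, hx⟩ := RingHom.Finite.exists_hom_int
      (RingHom.finite_algebraMap.2 h) v hz
    exact hx (hval f x)
  have hrat : ∀ (k : Type v) [Field k] (S : Type w) [Nonempty S],
      ¬ IsFiniteExtensionOfRationalFunctions k S F := by
    rintro k _ S _ ⟨φ, hφ⟩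
    obtain ⟨v, z, hz⟩ := MvPolynomial.exists_hom_int_ne_one (k := k) (S := S)
      (K := FractionRing (MvPolynomial S k))
    obtain ⟨f, x, hx⟩ := hφ.exists_hom_int v hz
    exact hx (hval f x)
  refine ⟨⟨t, ht⟩, ⟨htf, hrank⟩, ⟨halg, hnotfin, hrat, ?_, ?_, fun h => hnotfin h.finiteDimensional⟩,
    ?_⟩
  · rintro k _ n hn ⟨φ, hφ⟩
    have : Nonempty (Fin n) := ⟨⟨0, hn⟩⟩
    obtain ⟨v, z, hz⟩ := MvPolynomial.exists_hom_int_ne_one (k := k) (S := Fin n)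
      (K := FractionRing (MvPolynomial (Fin n) k))
    obtain ⟨f, x, hx⟩ := hφ.exists_hom_int v hz
    exact hx (hval f x)
  · rintro (h | ⟨p, _, φ, hφ⟩)
    · have : CharP F 2 := charP_of_injective_algebraMap (algebraMap (ZMod 2) F).injective 2
      have h0 : CharZero F := h.to_charZero
      exact two_ne_zero (α := F) (CharP.cast_eq_zero F 2)
    · obtain ⟨v, z, hz⟩ := RatFunc.exists_hom_int_ne_one (k := ZMod p)
      obtain ⟨f, x, hx⟩ := hφ.exists_hom_int v hz
      exact hx (hval f x)
  · rintro hTfin ⟨S, d, hS, htop⟩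
    have := hTfin.to_subtype
    have : CharP (IntermediateField.adjoin (ZMod 2) T) 2 :=
      charP_of_injective_algebraMap (algebraMap (ZMod 2) _).injective 2
    have := infinite_units F
    obtain ⟨x, hx⟩ := exists_ne (1 : Fˣ)
    obtain ⟨f, hf⟩ := exists_hom_int_ne_one_of_bounded_degree T (ZMod 2)
      (fun x hx => (hS x hx).2) htop hx
    exact hf (hval f x)
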